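/- Let $H=H_3(\mathbb Z)$ be the discrete Heisenberg group, i.e. the set $\mathbb Z^3$ with multiplication $$(x_1,y_1,z_1)(x_2,y_2,z_2)=(x_1+x_2,\;y_1+y_2,\;z_1+z_2+x_1y_2).$$ For a finite symmetric generating set $S$ of a group $G$ (symmetric: $S=S^{-1}$), let $|g|_S$ denote the word norm of $g\in G$, i.e. the least length of a word in the elements of $S$ whose product is $g$. Say that $S$ satisfies property EH if there is a constant $D>0$ such that for every $g_0$ in the commutator subgroup $G'=[G,G]$ there is $n\in\mathbb N$ such that for all $y\in G$, $$|y|_S>n\ \Longrightarrow\ \bigl|\,|g_0y|_S-|y|_S\,\bigr|\le D ;$$ the group $G$ satisfies property EH if every finite symmetric generating set of $G$ satisfies it. **Corollary.** The discrete Heisenberg group $H$ satisfies property EH. -/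

import Mathlib

/-- The discrete Heisenberg group `H₃(ℤ)`: the set `ℤ³`, with the group law
`(x₁, y₁, z₁) (x₂, y₂, z₂) = (x₁ + x₂, y₁ + y₂, z₁ + z₂ + x₁ y₂)`. -/
@[ext]
structure DiscreteHeisenberg where
  x : ℤ
  y : ℤ
  z : ℤ

namespace DiscreteHeisenberg

instance : Mul DiscreteHeisenberg :=
  ⟨fun a b => ⟨a.x + b.x, a.y + b.y, a.z + b.z + a.x * b.y⟩⟩

instance : One DiscreteHeisenberg := ⟨⟨0, 0, 0⟩⟩

instance : Inv DiscreteHeisenberg := ⟨fun a => ⟨-a.x, -a.y, -a.z + a.x * a.y⟩⟩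

@[simp] theorem mul_x (a b : DiscreteHeisenberg) : (a * b).x = a.x + b.x := rfl
@[simp] theorem mul_y (a b : DiscreteHeisenberg) : (a * b).y = a.y + b.y := rfl
@[simp] theorem mul_z (a b : DiscreteHeisenberg) : (a * b).z = a.z + b.z + a.x * b.y := rfl
@[simp] theorem one_x : (1 : DiscreteHeisenberg).x = 0 := rfl
@[simp] theorem one_y : (1 : DiscreteHeisenberg).y = 0 := rfl
@[simp] theorem one_z : (1 : DiscreteHeisenberg).z = 0 := rfl
@[simp] theorem inv_x (a : DiscreteHeisenberg) : a⁻¹.x = -a.x := rfl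
@[simp] theorem inv_y (a : DiscreteHeisenberg) : a⁻¹.y = -a.y := rfl
@[simp] theorem inv_z (a : DiscreteHeisenberg) : a⁻¹.z = -a.z + a.x * a.y := rfl

instance : Group DiscreteHeisenberg :=
  Group.ofLeftAxioms
    (fun a b c => by ext <;> simp <;> ring)
    (fun a => by ext <;> simp)
    (fun a => by ext <;> simp)

end DiscreteHeisenberg

/-- `S` is a finite symmetric generating set of the group `G`. -/
structure IsFiniteSymmetricGeneratingSet {G : Type*} [Group G] (S : Set G) : Prop where
  finite : S.Finite
  inv_mem : ∀ s ∈ S, s⁻¹ ∈ S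
  closure_eq_top : Subgroup.closure S = ⊤

/-- The word norm `|g|_S`: the least length of a word in the letters `S` with product `g`.
When `S` is a symmetric generating set, every `g` is the product of such a word. -/
noncomputable def wordNorm {G : Type*} [Group G] (S : Set G) (g : G) : ℕ :=
  sInf {n : ℕ | ∃ w : List G, (∀ s ∈ w, s ∈ S) ∧ w.prod = g ∧ w.length = n}

/-- The set `S` satisfies property EH: there is `D > 0` such that for every `g₀` in the commutator
subgroup there is `n` such that `| |g₀ y|_S - |y|_S | ≤ D` for all `y` with `|y|_S > n`. -/
def SatisfiesEH {G : Type*} [Group G] (S : Set G) : Prop :=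
  ∃ D : ℝ, 0 < D ∧ ∀ g₀ ∈ commutator G, ∃ n : ℕ, ∀ y : G, n < wordNorm S y →
    |(wordNorm S (g₀ * y) : ℝ) - (wordNorm S y : ℝ)| ≤ D

/-- A group satisfies EH if each of its finite symmetric generating sets does. -/
def PropertyEH (G : Type*) [Group G] : Prop :=
  ∀ S : Set G, IsFiniteSymmetricGeneratingSet S → SatisfiesEH S

/-! ### Word norms in an arbitrary group. -/

section WordNorm

variable {G : Type*} [Group G] {S : Set G}

/-! Elements of the commutator subgroup are central. Wrapping a prefix `p` of a geodesic word for
`g` between letters `a` and `a⁻¹` costs two letters and multiplies `g` by `central (form a p)`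
(`wordNorm_central_form_mul_le`). The pairing grows by bounded steps along the word, so once it
exceeds `|k|` some prefix realises `k` up to sign and a bounded error (`exists_form_take_near`). If
no pairing exceeds `|k|`, the prefixes have bounded abelianization, so the height is linear in the
length; since the centre is distorted, such a geodesic is short (`exists_length_le_of_form_le`).
Using `-k` as well gives the reverse inequality. -/

theorem wordNorm_prod_le {w : List G} (hw : ∀ s ∈ w, s ∈ S) : wordNorm S w.prod ≤ w.length :=
  Nat.sInf_le ⟨w, hw, rfl, rfl⟩

namespace IsFiniteSymmetricGeneratingSet

theorem exists_word (hS : IsFiniteSymmetricGeneratingSet S) (g : G) :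
    ∃ w : List G, (∀ s ∈ w, s ∈ S) ∧ w.prod = g ∧ w.length = wordNorm S g := by
  have hne : {n : ℕ | ∃ w : List G, (∀ s ∈ w, s ∈ S) ∧ w.prod = g ∧ w.length = n}.Nonempty := by
    have hg : g ∈ Submonoid.closure (S ∪ S⁻¹) := by
      rw [← Subgroup.closure_toSubmonoid, hS.closure_eq_top]; trivial
    obtain ⟨l, hl, hprod⟩ := Submonoid.exists_list_of_mem_closure hg
    refine ⟨l.length, l, fun s hs => ?_, hprod, rfl⟩
    rcases hl s hs with h | h
    · exact h
    · simpa using hS.inv_mem _ h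
  exact Nat.sInf_mem hne

theorem wordNorm_mul_le (hS : IsFiniteSymmetricGeneratingSet S) (g h : G) :
    wordNorm S (g * h) ≤ wordNorm S g + wordNorm S h := by
  obtain ⟨u, hu, rfl, hul⟩ := hS.exists_word g
  obtain ⟨v, hv, rfl, hvl⟩ := hS.exists_word h
  rw [← hul, ← hvl, ← List.prod_append, ← List.length_append]
  refine wordNorm_prod_le fun s hs => ?_
  rcases List.mem_append.1 hs with h | h
  exacts [hu s h, hv s h]

theorem wordNorm_inv_le (hS : IsFiniteSymmetricGeneratingSet S) (g : G) :
    wordNorm S g⁻¹ ≤ wordNorm S g := by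
  obtain ⟨u, hu, rfl, hul⟩ := hS.exists_word g
  rw [← hul, List.prod_inv_reverse]
  refine (wordNorm_prod_le fun s hs => ?_).trans (by simp)
  obtain ⟨t, ht, rfl⟩ := List.mem_map.1 (List.mem_reverse.1 hs)
  exact hS.inv_mem t (hu t ht)

theorem wordNorm_pow_le (hS : IsFiniteSymmetricGeneratingSet S) (g : G) (n : ℕ) :
    wordNorm S (g ^ n) ≤ n * wordNorm S g := by
  induction n with
  | zero => simpa using wordNorm_prod_le (S := S) (w := []) (by simp)
  | succ n ih =>
    rw [pow_succ, add_mul, one_mul]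
    exact (hS.wordNorm_mul_le _ _).trans (by omega)

theorem wordNorm_zpow_le (hS : IsFiniteSymmetricGeneratingSet S) (g : G) (n : ℤ) :
    wordNorm S (g ^ n) ≤ n.natAbs * wordNorm S g := by
  obtain ⟨m, rfl | rfl⟩ := n.eq_nat_or_neg
  · simpa using hS.wordNorm_pow_le g m
  · simpa using (hS.wordNorm_inv_le _).trans (hS.wordNorm_pow_le g m)

end IsFiniteSymmetricGeneratingSet

end WordNorm

/-! ### Coordinates, the determinant form and the centre. -/

namespace DiscreteHeisenberg

/-- The central element `(0, 0, k)`. -/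
def central (k : ℤ) : DiscreteHeisenberg := ⟨0, 0, k⟩

/-- The determinant form on the abelianization, pulled back to the group. -/
def form (a b : DiscreteHeisenberg) : ℤ := a.x * b.y - a.y * b.x

@[simp] theorem central_x (k : ℤ) : (central k).x = 0 := rfl
@[simp] theorem central_y (k : ℤ) : (central k).y = 0 := rfl
@[simp] theorem central_z (k : ℤ) : (central k).z = k := rfl

theorem central_add (j k : ℤ) : central (j + k) = central j * central k := by
  ext <;> simp

theorem conj_eq (a g : DiscreteHeisenberg) : a * g * a⁻¹ = central (form a g) * g := by
  ext
  · simp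
  · simp
  · simp [form]; ring

theorem form_mul_left (a b g : DiscreteHeisenberg) : form (a * b) g = form a g + form b g := by
  simp [form]; ring

theorem form_mul_right (g a b : DiscreteHeisenberg) : form g (a * b) = form g a + form g b := by
  simp [form]; ring

theorem form_inv_left (a g : DiscreteHeisenberg) : form a⁻¹ g = -form a g := by
  simp [form]; ring

/-- Powers are taken coordinatewise on the axes, where no cross term appears. -/
theorem zpow_eq (g : DiscreteHeisenberg) (hg : g.x * g.y = 0) (k : ℤ) :
    g ^ k = ⟨k * g.x, k * g.y, k * g.z⟩ := by
  induction k using Int.induction_on with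
  | zero => ext <;> simp
  | succ n ih =>
    rw [zpow_add_one, ih]
    ext
    · simp; ring
    · simp; ring
    · simp; linear_combination (n : ℤ) * hg
  | pred n ih =>
    rw [zpow_sub_one, ih]
    ext
    · simp; ring
    · simp; ring
    · simp; linear_combination (1 + n : ℤ) * hg

theorem central_eq_zpow (k : ℤ) : central k = central 1 ^ k := by
  rw [zpow_eq _ (by simp)]; ext <;> simp

/-- The generator `(1, 0, 0)`. -/
def genX : DiscreteHeisenberg := ⟨1, 0, 0⟩

/-- The generator `(0, 1, 0)`. -/
def genY : DiscreteHeisenberg := ⟨0, 1, 0⟩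

theorem form_genX (g : DiscreteHeisenberg) : form genX g = g.y := by simp [form, genX]

theorem form_genY (g : DiscreteHeisenberg) : form genY g = -g.x := by simp [form, genY]

theorem genX_zpow (k : ℤ) : genX ^ k = ⟨k, 0, 0⟩ := by
  rw [zpow_eq _ (by simp [genX])]; ext <;> simp [genX]

theorem genY_zpow (k : ℤ) : genY ^ k = ⟨0, k, 0⟩ := by
  rw [zpow_eq _ (by simp [genY])]; ext <;> simp [genY]

theorem eq_genY_genX_central (g : DiscreteHeisenberg) :
    g = genY ^ g.y * genX ^ g.x * central g.z := by
  rw [genX_zpow, genY_zpow]; ext <;> simp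

/-- A word of length linear in `m` reaches quadratic height: the source of the distortion of the
centre. -/
theorem central_sq (m : ℤ) :
    central (m ^ 2) = genX ^ m * genY ^ m * genX ^ (-m) * genY ^ (-m) := by
  rw [genX_zpow, genY_zpow, genX_zpow, genY_zpow]; ext <;> simp; ring

theorem eq_central_of_mem_commutator {g : DiscreteHeisenberg}
    (hg : g ∈ commutator DiscreteHeisenberg) : g = central g.z := by
  let f : DiscreteHeisenberg →* Multiplicative (ℤ × ℤ) :=
    { toFun := fun a => Multiplicative.ofAdd (a.x, a.y)
      map_one' := rfl
      map_mul' := fun _ _ => rfl }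
  have h : f g = 1 := Abelianization.commutator_subset_ker f hg
  have h' : (g.x, g.y) = ((0 : ℤ), (0 : ℤ)) := congrArg Multiplicative.toAdd h
  rw [Prod.mk.injEq] at h'
  ext <;> simp [h'.1, h'.2]

/-! ### Distortion and geodesics with bounded pairings. -/

variable {S : Set DiscreteHeisenberg}

theorem exists_coord_bound (hS : S.Finite) :
    ∃ B : ℕ, ∀ s ∈ S, |s.x| ≤ B ∧ |s.y| ≤ B ∧ |s.z| ≤ B := by
  obtain ⟨B, hB⟩ :=
    (hS.image fun s => s.x.natAbs + s.y.natAbs + s.z.natAbs).bddAbove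
  refine ⟨B, fun s hs => ?_⟩
  have : s.x.natAbs + s.y.natAbs + s.z.natAbs ≤ B := hB (Set.mem_image_of_mem _ hs)
  simp only [Int.abs_eq_natAbs]
  omega

theorem exists_form_bound (hS : S.Finite) :
    ∃ C : ℕ, ∀ a ∈ S, ∀ b ∈ S, form a b ≤ C := by
  obtain ⟨C, hC⟩ := ((hS.prod hS).image fun p => (form p.1 p.2).natAbs).bddAbove
  refine ⟨C, fun a ha b hb => ?_⟩
  have : (form a b).natAbs ≤ C := hC (Set.mem_image_of_mem _ (Set.mk_mem_prod ha hb))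
  omega

theorem abs_form_prod_le {w : List DiscreteHeisenberg} {p : DiscreteHeisenberg} {K : ℤ}
    (h : ∀ s ∈ w, |form s p| ≤ K) : |form w.prod p| ≤ w.length * K := by
  induction w with
  | nil => simp [form]
  | cons s w ih =>
    rw [List.forall_mem_cons] at h
    rw [List.prod_cons, form_mul_left, List.length_cons]
    push_cast
    linarith [abs_add_le (form s p) (form w.prod p), ih h.2, h.1]

/-- Additivity in the first argument; applied to `genX` and `genY`, it turns pairing bounds into
coordinate bounds. -/
theorem abs_form_le (hS : IsFiniteSymmetricGeneratingSet S) {p : DiscreteHeisenberg} {K : ℤ}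
    (h : ∀ s ∈ S, |form s p| ≤ K) (g : DiscreteHeisenberg) :
    |form g p| ≤ wordNorm S g * K := by
  obtain ⟨u, hu, hp, hl⟩ := hS.exists_word g
  rw [← hl, ← hp]
  exact abs_form_prod_le fun s hs => h s (hu s hs)

/-- A word whose prefixes have bounded abscissa has height at most linear in its length. -/
theorem abs_prod_z_le {B R : ℕ} (hB : ∀ s ∈ S, |s.x| ≤ B ∧ |s.y| ≤ B ∧ |s.z| ≤ B)
    (w : List DiscreteHeisenberg) (hw : ∀ s ∈ w, s ∈ S)
    (hR : ∀ i, |(w.take i).prod.x| ≤ R) : |w.prod.z| ≤ w.length * (B + R * B : ℕ) := by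
  induction w using List.reverseRecOn with
  | nil => simp
  | append_singleton w s ih =>
    have hs := hB s (hw s (by simp))
    have hx : |w.prod.x| ≤ R := by simpa using hR w.length
    have ih := ih (fun t ht => hw t (by simp [ht])) fun i => by
      rcases le_total i w.length with hi | hi
      · simpa [List.take_append_of_le_length hi] using hR i
      · simpa [List.take_of_length_le hi] using hx
    have hxy : |w.prod.x * s.y| ≤ R * B := by
      rw [abs_mul]; exact mul_le_mul hx hs.2.1 (abs_nonneg _) (by positivity)
    rw [List.prod_append, List.prod_singleton, mul_z, List.length_append, List.length_singleton]
    push_cast at ih ⊢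
    linarith [abs_add_le (w.prod.z + s.z) (w.prod.x * s.y), abs_add_le w.prod.z s.z, hs.2.2]

/-- The centre is distorted: its word norm grows slower than any linear function. -/
theorem exists_wordNorm_central_le (hS : IsFiniteSymmetricGeneratingSet S) :
    ∃ A : ℕ, ∀ m : ℕ, 0 < m → ∃ E : ℕ, ∀ k : ℤ,
      m * wordNorm S (central k) ≤ A * k.natAbs + E := by
  set a := wordNorm S genX
  set b := wordNorm S genY
  set c := wordNorm S (central 1)
  refine ⟨2 * a + 2 * b, fun m hm => ⟨m * m * (2 * a + 2 * b) + m * (m ^ 2 * c), fun k => ?_⟩⟩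
  have hm2 : (0 : ℤ) < (m : ℤ) ^ 2 := by positivity
  have hsq : wordNorm S (central ((m : ℤ) ^ 2)) ≤ m * (2 * a + 2 * b) := by
    rw [central_sq]
    have h1 := hS.wordNorm_zpow_le genX m
    have h2 := hS.wordNorm_zpow_le genY m
    have h3 := hS.wordNorm_zpow_le genX (-m)
    have h4 := hS.wordNorm_zpow_le genY (-m)
    have h5 := hS.wordNorm_mul_le (genX ^ (m : ℤ) * genY ^ (m : ℤ) * genX ^ (-m : ℤ))
      (genY ^ (-m : ℤ))
    have h6 := hS.wordNorm_mul_le (genX ^ (m : ℤ) * genY ^ (m : ℤ)) (genX ^ (-m : ℤ))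
    have h7 := hS.wordNorm_mul_le (genX ^ (m : ℤ)) (genY ^ (m : ℤ))
    simp only [Int.natAbs_neg, Int.natAbs_natCast] at h1 h2 h3 h4
    linarith
  have hdecomp : central k = central ((m : ℤ) ^ 2) ^ (k / (m : ℤ) ^ 2) *
      central 1 ^ (k % (m : ℤ) ^ 2) := by
    rw [← central_eq_zpow, zpow_eq _ (by simp)]
    ext <;> simp [Int.ediv_mul_add_emod]
  have hq : m ^ 2 * (k / (m : ℤ) ^ 2).natAbs ≤ k.natAbs + m ^ 2 := by
    have h0 := Int.emod_nonneg k hm2.ne'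
    have h1 := Int.emod_lt_of_pos k hm2
    have h2 := Int.mul_ediv_add_emod k ((m : ℤ) ^ 2)
    zify
    rw [← abs_of_pos hm2, ← abs_mul, abs_of_pos hm2]
    have : (m : ℤ) ^ 2 * (k / (m : ℤ) ^ 2) = k - k % (m : ℤ) ^ 2 := by linarith
    rw [this]
    exact (abs_sub _ _).trans (by rw [abs_of_nonneg h0]; linarith)
  have hr : (k % (m : ℤ) ^ 2).natAbs ≤ m ^ 2 := by
    have h0 := Int.emod_nonneg k hm2.ne'
    have h1 := Int.emod_lt_of_pos k hm2
    zify
    rw [abs_of_nonneg h0]; exact h1.le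
  have hk : wordNorm S (central k) ≤
      (k / (m : ℤ) ^ 2).natAbs * (m * (2 * a + 2 * b)) + m ^ 2 * c := by
    rw [hdecomp]
    refine (hS.wordNorm_mul_le _ _).trans (add_le_add ?_ ?_)
    · exact (hS.wordNorm_zpow_le _ _).trans (Nat.mul_le_mul_left _ hsq)
    · exact (hS.wordNorm_zpow_le _ _).trans (Nat.mul_le_mul_right _ hr)
  calc m * wordNorm S (central k)
      ≤ m * ((k / (m : ℤ) ^ 2).natAbs * (m * (2 * a + 2 * b)) + m ^ 2 * c) :=
        Nat.mul_le_mul_left _ hk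
    _ = m ^ 2 * (k / (m : ℤ) ^ 2).natAbs * (2 * a + 2 * b) + m * (m ^ 2 * c) := by ring
    _ ≤ (k.natAbs + m ^ 2) * (2 * a + 2 * b) + m * (m ^ 2 * c) := by gcongr
    _ = _ := by ring

/-- Geodesic words whose prefixes pair boundedly with the generators are short. -/
theorem exists_length_le_of_form_le (hS : IsFiniteSymmetricGeneratingSet S) (K : ℕ) :
    ∃ N : ℕ, ∀ w : List DiscreteHeisenberg, (∀ s ∈ w, s ∈ S) → w.length = wordNorm S w.prod →
      (∀ a ∈ S, ∀ i, form a (w.take i).prod ≤ K) → w.length ≤ N := by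
  obtain ⟨B, hB⟩ := exists_coord_bound hS.finite
  obtain ⟨A, hA⟩ := exists_wordNorm_central_le hS
  set a := wordNorm S genX
  set b := wordNorm S genY
  set M := B + b * K * B
  -- The height is at most `M` times the length, so the multiplier `A * M + 1` leaves one copy of
  -- the length after absorbing `A * M` copies.
  obtain ⟨E, hE⟩ := hA (A * M + 1) (by omega)
  refine ⟨(A * M + 1) * (a * K * b + b * K * a) + E, fun w hw hgeo hform => ?_⟩
  -- Symmetry of `S` makes the one-sided bound two-sided.
  have habs : ∀ i, ∀ s ∈ S, |form s (w.take i).prod| ≤ K := fun i s hs => by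
    rw [abs_le]
    have h := hform _ (hS.inv_mem s hs) i
    rw [form_inv_left] at h
    exact ⟨by linarith, hform s hs i⟩
  have hy : |w.prod.y| ≤ a * K := by
    simpa only [form_genX, List.take_length] using abs_form_le hS (habs w.length) genX
  have hx : ∀ i, |(w.take i).prod.x| ≤ b * K := fun i => by
    simpa only [form_genY, abs_neg] using abs_form_le hS (habs i) genY
  have hz : |w.prod.z| ≤ w.length * (M : ℕ) :=
    abs_prod_z_le hB w hw fun i => by exact_mod_cast hx i
  have hx' : w.prod.x.natAbs ≤ b * K := by
    have := hx w.length
    rw [List.take_length] at this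
    zify; exact this
  have hy' : w.prod.y.natAbs ≤ a * K := by zify; exact hy
  have hz' : w.prod.z.natAbs ≤ w.length * M := by zify; exact_mod_cast hz
  have hnorm : w.length ≤ a * K * b + b * K * a + wordNorm S (central w.prod.z) := by
    rw [hgeo]
    nth_rw 1 [eq_genY_genX_central w.prod]
    refine (hS.wordNorm_mul_le _ _).trans (add_le_add_left
      ((hS.wordNorm_mul_le _ _).trans (add_le_add ?_ ?_)) _)
    · exact (hS.wordNorm_zpow_le _ _).trans (Nat.mul_le_mul_right _ hy')
    · exact (hS.wordNorm_zpow_le _ _).trans (Nat.mul_le_mul_right _ hx')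
  have h1 := Nat.mul_le_mul_left (A * M + 1) hnorm
  have h2 := hE w.prod.z
  have h3 := Nat.mul_le_mul_left A hz'
  nlinarith

/-! ### Central shifts by insertion. -/

/-- Inserting `a` and `a⁻¹` around a prefix of a word multiplies it by a central element. -/
theorem wordNorm_central_form_mul_le (hS : IsFiniteSymmetricGeneratingSet S)
    {w : List DiscreteHeisenberg} (hw : ∀ s ∈ w, s ∈ S) {a : DiscreteHeisenberg} (ha : a ∈ S)
    (i : ℕ) : wordNorm S (central (form a (w.take i).prod) * w.prod) ≤ w.length + 2 := by
  have heq : central (form a (w.take i).prod) * w.prod =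
      (a :: (w.take i ++ a⁻¹ :: w.drop i)).prod := by
    have hsplit := List.prod_take_mul_prod_drop w i
    rw [← congrArg (central (form a (w.take i).prod) * ·) hsplit, ← mul_assoc, ← conj_eq]
    simp only [List.prod_cons, List.prod_append, mul_assoc]
  have hlen : (a :: (w.take i ++ a⁻¹ :: w.drop i)).length = w.length + 2 := by
    simp only [List.length_cons, List.length_append, List.length_take, List.length_drop]
    omega
  rw [heq, ← hlen]
  refine wordNorm_prod_le fun s hs => ?_
  simp only [List.mem_cons, List.mem_append] at hs
  rcases hs with rfl | hs | rfl | hs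
  · exact ha
  · exact hw s (List.mem_of_mem_take hs)
  · exact hS.inv_mem a ha
  · exact hw s (List.mem_of_mem_drop hs)

/-- If a pairing of a prefix with a generator exceeds `K`, then some prefix pairs with it to a
value close to `K`. -/
theorem exists_form_take_near {C : ℕ} (hC : ∀ a ∈ S, ∀ b ∈ S, form a b ≤ C)
    {w : List DiscreteHeisenberg} (hw : ∀ s ∈ w, s ∈ S) {a : DiscreteHeisenberg} (ha : a ∈ S)
    {K i : ℕ} (hi : K ≤ form a (w.take i).prod) :
    ∃ j, K ≤ form a (w.take j).prod ∧ form a (w.take j).prod ≤ K + C := by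
  classical
  have hex : ∃ i, (K : ℤ) ≤ form a (w.take i).prod := ⟨i, hi⟩
  refine ⟨Nat.find hex, Nat.find_spec hex, ?_⟩
  rcases hj : Nat.find hex with _ | j
  · simp [form]; positivity
  · have hlt : form a (w.take j).prod < K := not_le.1 (Nat.find_min hex (by omega))
    by_cases hjw : j < w.length
    · rw [List.prod_take_succ _ _ hjw, form_mul_right]
      linarith [hC a ha _ (hw _ (List.getElem_mem hjw))]
    · rw [List.take_of_length_le (by omega)] at hlt ⊢
      linarith [Int.natCast_nonneg C]

theorem exists_wordNorm_central_mul_le (hS : IsFiniteSymmetricGeneratingSet S) :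
    ∃ D : ℕ, ∀ k : ℤ, ∃ N : ℕ, ∀ g : DiscreteHeisenberg, N < wordNorm S g →
      wordNorm S (central k * g) ≤ wordNorm S g + D := by
  obtain ⟨C, hC⟩ := exists_form_bound hS.finite
  -- Two inserted letters plus a central correction of height at most `C`, independent of `k`.
  refine ⟨2 + C * wordNorm S (central 1), fun k => ?_⟩
  obtain ⟨N, hN⟩ := exists_length_le_of_form_le hS k.natAbs
  refine ⟨N, fun g hg => ?_⟩
  obtain ⟨w, hw, rfl, hl⟩ := hS.exists_word g
  have hnot : ∃ a ∈ S, ∃ i, (k.natAbs : ℤ) < form a (w.take i).prod := by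
    by_contra! hcon
    have := hN w hw hl hcon
    omega
  obtain ⟨a, ha, i, hi⟩ := hnot
  obtain ⟨j, hj1, hj2⟩ := exists_form_take_near hC hw ha hi.le
  -- The pairing is close to `|k|`; replacing `a` by `a⁻¹` supplies the sign of `k`.
  obtain ⟨e, he, hke⟩ : ∃ e ∈ S, (k - form e (w.take j).prod).natAbs ≤ C := by
    rcases le_total 0 k with hk | hk
    · exact ⟨a, ha, by omega⟩
    · exact ⟨a⁻¹, hS.inv_mem a ha, by rw [form_inv_left]; omega⟩
  have h1 := wordNorm_central_form_mul_le hS hw he j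
  have h2 : wordNorm S (central (k - form e (w.take j).prod)) ≤ C * wordNorm S (central 1) := by
    rw [central_eq_zpow]
    exact (hS.wordNorm_zpow_le _ _).trans (Nat.mul_le_mul_right _ hke)
  have h3 : central k * w.prod = central (k - form e (w.take j).prod) *
      (central (form e (w.take j).prod) * w.prod) := by
    rw [← mul_assoc, ← central_add, sub_add_cancel]
  have h4 := hS.wordNorm_mul_le (central (k - form e (w.take j).prod))
    (central (form e (w.take j).prod) * w.prod)
  rw [h3]
  omega

end DiscreteHeisenberg

open DiscreteHeisenberg

theorem mainTheorem4 : PropertyEH DiscreteHeisenberg := by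
  intro S hS
  obtain ⟨D, hD⟩ := exists_wordNorm_central_mul_le hS
  refine ⟨D + 1, by positivity, fun g₀ hg₀ => ?_⟩
  rw [eq_central_of_mem_commutator hg₀]
  set k := g₀.z
  obtain ⟨N₁, hN₁⟩ := hD k
  obtain ⟨N₂, hN₂⟩ := hD (-k)
  -- The last term keeps the norm of `central k * g` above `N₂`.
  refine ⟨N₁ + N₂ + wordNorm S (central (-k)), fun g hg => ?_⟩
  have hcancel : central (-k) * (central k * g) = g := by
    rw [← mul_assoc, ← central_add, neg_add_cancel]
    ext <;> simp
  have h1 := hN₁ g (by omega)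
  have h2 := hS.wordNorm_mul_le (central (-k)) (central k * g)
  rw [hcancel] at h2
  have h3 := hN₂ (central k * g) (by omega)
  rw [hcancel] at h3
  have h1' : (wordNorm S (central k * g) : ℝ) ≤ wordNorm S g + D := by exact_mod_cast h1
  have h3' : (wordNorm S g : ℝ) ≤ wordNorm S (central k * g) + D := by exact_mod_cast h3
  rw [abs_le]
  constructor <;> linarith
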